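/- For a topological space $X$ (no separation axioms assumed), a cellular family in $X$ is a family of pairwise disjoint nonempty open subsets of $X$, and the Souslin number $S(X)$ is the least cardinal $\lambda$ such that no cellular family in $X$ has cardinality $\lambda$ (finite values are allowed). For an infinite cardinal $\kappa$ and a family $\{X_i : i\in I\}$ of topological spaces, $(X_I)_\kappa$ denotes the product $X_I=\prod_{i\in I}X_i$ with the $\kappa$-box topology, i.e. the topology having as a base all products $\prod_{i\in I}U_i$ with each $U_i$ open in $X_i$ and $|\{i\in I: U_i\neq X_i\}|<\kappa$. Write $\beta^+$ for the least cardinal greater than $\beta$ (so $n^+=n+1$ for finite $n$), and $2^{<\kappa}:=\sum_{\lambda<\kappa}2^{\lambda}$, the sum being over cardinals $\lambda<\kappa$ (equivalently, $2^{<\kappa}=\sup_{\lambda<\kappa}2^\lambda$, since $\kappa$ is infinite). **Corollary 4.40.** Let $\alpha\ge 3$ and $\kappa\ge\omega$ be cardinals, and let $\{X_i:i\in I\}$ be a family of topological spaces such that $|I|^+\ge\kappa$ and $3\le S(X_i)\le\alpha^+$ for each $i\in I$. If $\alpha^+\le\kappa$, then $$S\big((X_I)_\kappa\big)=(2^{<\kappa})^+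 .$$ (Here $\kappa$ may be regular or singular.) -/

import Mathlib

open Cardinal Set TopologicalSpace

universe u

/-- A cellular family in a space `X`: a family of pairwise disjoint nonempty open subsets. -/
def IsCellular {X : Type u} [TopologicalSpace X] (A : Set (Set X)) : Prop :=
  (∀ U ∈ A, IsOpen U ∧ U.Nonempty) ∧ A.PairwiseDisjoint id

/-- The Souslin number `S(X)`: the least cardinal `c` such that no cellular family in `X`
has cardinality exactly `c`. Finite values are allowed. -/
noncomputable def souslinNumber (X : Type u) [TopologicalSpace X] : Cardinal.{u} :=
  sInf {c : Cardinal.{u} | ¬ ∃ A : Set (Set X), IsCellular A ∧ #A = c}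

/-- The least cardinal in the definition of `S(X)` is a minimum of a nonempty class. -/
theorem souslinNumber_set_nonempty (X : Type u) [TopologicalSpace X] :
    {c : Cardinal.{u} | ¬ ∃ A : Set (Set X), IsCellular A ∧ #A = c}.Nonempty := by
  refine ⟨Order.succ #(Set X), ?_⟩
  rintro ⟨A, -, hA⟩
  exact absurd (hA ▸ mk_set_le A) (not_le.2 (Order.lt_succ _))

/-- The canonical open sets of the `κ`-box topology: products `∏ U i` of open sets with fewer
than `κ` many indices `i` such that `U i ≠ X i`. -/
def canonicalOpens {I : Type u} (X : I → Type u) [∀ i, TopologicalSpace (X i)]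
    (κ : Cardinal.{u}) : Set (Set (∀ i, X i)) :=
  {s | ∃ U : ∀ i, Set (X i), (∀ i, IsOpen (U i)) ∧ #{i | U i ≠ Set.univ} < κ ∧ s = Set.univ.pi U}

/-- The `κ`-box topology on the product of the spaces `X i`. -/
@[reducible]
def kappaBoxTopology {I : Type u} (X : I → Type u) [∀ i, TopologicalSpace (X i)]
    (κ : Cardinal.{u}) : TopologicalSpace (∀ i, X i) :=
  generateFrom (canonicalOpens X κ)

/-- For infinite `κ` the canonical open sets are a base of the `κ`-box topology. -/
theorem isTopologicalBasis_canonicalOpens {I : Type u} (X : I → Type u)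
    [∀ i, TopologicalSpace (X i)] (κ : Cardinal.{u}) (hκ : ℵ₀ ≤ κ) :
    @IsTopologicalBasis _ (kappaBoxTopology X κ) (canonicalOpens X κ) := by
  let _ := kappaBoxTopology X κ
  refine ⟨?_, ?_, rfl⟩
  · rintro _ ⟨U, hU, hUκ, rfl⟩ _ ⟨V, hV, hVκ, rfl⟩ x hx
    refine ⟨_, ⟨fun i => U i ∩ V i, fun i => (hU i).inter (hV i), ?_, rfl⟩, ?_, ?_⟩
    · refine lt_of_le_of_lt (mk_le_mk_of_subset ?_)
        (lt_of_le_of_lt (mk_union_le {i | U i ≠ Set.univ} {i | V i ≠ Set.univ})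
          (add_lt_of_lt hκ hUκ hVκ))
      intro i hi
      by_contra h
      simp only [mem_union, mem_ofPred_eq, not_or, not_not] at h
      exact hi (by simp [h.1, h.2])
    · exact fun i hi => ⟨hx.1 i hi, hx.2 i hi⟩
    · exact fun y hy => ⟨fun i hi => (hy i hi).1, fun i hi => (hy i hi).2⟩
  · refine eq_univ_of_forall fun x => mem_sUnion.2 ⟨Set.univ, ?_, mem_univ x⟩
    exact ⟨fun _ => Set.univ, fun _ => isOpen_univ, by simpa using aleph0_pos.trans_le hκ, by simp⟩

/-- The space `(X_I)_κ`: the product `∏ i, X i` equipped with the `κ`-box topology. (A type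
synonym, so that the usual product topology is not picked up.) -/
def KappaBox {I : Type u} (X : I → Type u) [∀ i, TopologicalSpace (X i)]
    (_κ : Cardinal.{u}) : Type u :=
  ∀ i, X i

instance KappaBox.instTopologicalSpace {I : Type u} (X : I → Type u) [∀ i, TopologicalSpace (X i)] (κ : Cardinal.{u}) :
    TopologicalSpace (KappaBox X κ) :=
  kappaBoxTopology X κ

/-! Upper bound: shrink a cellular family to disjoint boxes and sort them by support size `μ < κ`.
Colour a pair by the position, in the support of the earlier box, of a coordinate where the two are
disjoint. In the canonical Erdős–Rado tree, boxes below `b` that share a separating coordinate have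
pairwise disjoint sides there, so branches have at most `μ * α < κ` members (`mk_branch_le`). Levels
have size at most `2 ^< κ` (`TreeLT.mk_level_le`), and there are at most `κ` of them. Regularity of
`κ` plays no role.

Lower bound: two disjoint open sets in each factor turn pairwise incompatible partial functions `I →
Bool` into disjoint boxes (`mk_lt_souslinNumber_kappaBox`). Enough such functions come from all
total ones if `#I < κ`, and from `selectorCode` otherwise. -/

theorem le_two_powerlt (κ : Cardinal.{u}) : κ ≤ (2 : Cardinal.{u}) ^< κ :=
  le_of_forall_lt fun c hc => (cantor c).trans_le (le_powerlt 2 hc)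

theorem mk_Iio_ord_lt {κ : Cardinal.{u}} (k : κ.ord.ToType) : #(Iio k) < κ := by
  simpa using mk_Iio_lt k (by simp)

theorem mul_two_powerlt_le {κ : Cardinal.{u}} (hκ : ℵ₀ ≤ κ) :
    κ * (2 : Cardinal.{u}) ^< κ ≤ (2 : Cardinal.{u}) ^< κ :=
  mul_le_of_le (hκ.trans (le_two_powerlt κ)) (le_two_powerlt κ) le_rfl

theorem power_le_two_powerlt {κ a b : Cardinal.{u}} (hκ : ℵ₀ ≤ κ) (ha : a < κ) (hb : b < κ) :
    a ^ b ≤ (2 : Cardinal.{u}) ^< κ :=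
  calc a ^ b ≤ (2 ^ a) ^ b := power_le_power_right (cantor a).le
    _ = 2 ^ (a * b) := power_mul.symm
    _ ≤ _ := le_powerlt 2 (mul_lt_of_lt hκ ha hb)

/-! ### The canonical tree of a colouring -/

/-- The canonical tree order of a colouring `c` of the pairs of a well-ordered set: `a` precedes `b`
when `a < b` and every tree predecessor of `a` precedes `b` too and gives both the same colour. -/
def TreeLT {T : Type u} {M : Type u} [LinearOrder T] [WellFoundedLT T] (c : T → T → M)
    (a b : T) : Prop :=
  a < b ∧ ∀ x, x < a → TreeLT c x a → TreeLT c x b ∧ c x a = c x b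
termination_by (wellFounded_lt (α := T)).wrap a
decreasing_by all_goals assumption

namespace TreeLT

variable {T : Type u} {M : Type u} [LinearOrder T] [WellFoundedLT T] {c : T → T → M}

theorem lt {a b : T} (h : TreeLT c a b) : a < b := by
  rw [TreeLT] at h
  exact h.1

theorem trans {x a b : T} (hx : TreeLT c x a) (h : TreeLT c a b) : TreeLT c x b := by
  rw [TreeLT] at h
  exact (h.2 x hx.lt hx).1

theorem color_eq {x a b : T} (hx : TreeLT c x a) (h : TreeLT c a b) : c x a = c x b := by
  rw [TreeLT] at h
  exact (h.2 x hx.lt hx).2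

theorem of_forall {a b : T} (hab : a < b)
    (h : ∀ x, TreeLT c x a → TreeLT c x b ∧ c x a = c x b) : TreeLT c a b := by
  rw [TreeLT]
  exact ⟨hab, fun x _ hx => h x hx⟩

/-- Two tree predecessors of the same element are comparable in the tree. -/
theorem of_lt {a b : T} (hb : ∀ x, x < a → TreeLT c x a → TreeLT c x b)
    {z : T} (ha : TreeLT c a z) (hbz : TreeLT c b z) (hab : a < b) : TreeLT c a b :=
  of_forall hab fun x hx =>
    have hxb := hb x hx.lt hx
    ⟨hxb, (hx.color_eq ha).trans (hxb.color_eq hbz).symm⟩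

theorem total {a b z : T} (ha : TreeLT c a z) (hb : TreeLT c b z) (hab : a < b) :
    TreeLT c a b := by
  induction a using WellFoundedLT.induction with
  | _ a ih =>
    exact of_lt (fun x hxa hx => ih x hxa (hx.trans ha) (hxa.trans hab)) ha hb hab

/-- An element is determined by its tree predecessors and the colours they give to it. -/
theorem eq_of_forall {a b : T} (h : ∀ x, TreeLT c x a ↔ TreeLT c x b)
    (hc : ∀ x, TreeLT c x a → c x a = c x b) : a = b := by
  rcases lt_trichotomy a b with hab | hab | hab
  · exact absurd ((h a).2 (of_forall hab fun x hx => ⟨(h x).1 hx, hc x hx⟩)).lt (lt_irrefl a)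
  · exact hab
  · exact absurd ((h b).1 (of_forall hab fun x hx =>
      ⟨(h x).2 hx, (hc x ((h x).2 hx)).symm⟩)).lt (lt_irrefl b)

instance : IsWellFounded T (TreeLT c) :=
  ⟨Subrelation.wf (fun h => h.lt) (wellFounded_lt (α := T))⟩

theorem exists_rank_eq {b : T} {o : Ordinal.{u}} (ho : o < IsWellFounded.rank (TreeLT c) b) :
    ∃ a, TreeLT c a b ∧ IsWellFounded.rank (TreeLT c) a = o := by
  induction b using WellFoundedLT.induction with
  | _ b ih =>
    have ho' := ho
    rw [IsWellFounded.rank_eq, Ordinal.lt_iSup_iff] at ho'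
    obtain ⟨⟨a, ha⟩, hoa⟩ := ho'
    rcases (Order.lt_succ_iff.1 hoa).eq_or_lt with rfl | hlt
    · exact ⟨a, ha, rfl⟩
    · obtain ⟨x, hx, hxo⟩ := ih a ha.lt hlt
      exact ⟨x, hx.trans ha, hxo⟩

theorem rank_lt_ord {κ : Cardinal.{u}} {b : T} (hb : #{a | TreeLT c a b} < κ) :
    IsWellFounded.rank (TreeLT c) b < κ.ord := by
  rw [lt_ord]
  refine lt_of_le_of_lt ?_ hb
  let f : {a | TreeLT c a b} → Iio (IsWellFounded.rank (TreeLT c) b) :=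
    fun a => ⟨IsWellFounded.rank (TreeLT c) a.1, IsWellFounded.rank_lt_of_rel a.2⟩
  have hf : Function.Surjective f := by
    rintro ⟨o, ho⟩
    obtain ⟨a, ha, rfl⟩ := exists_rank_eq ho
    exact ⟨⟨a, ha⟩, rfl⟩
  have := lift_mk_le_lift_mk_of_surjective hf
  rw [mk_Iio_ordinal, lift_id'.{u, u+1}] at this
  exact lift_le.1 this

/-- Each level of the canonical tree injects into the functions from its height to the colours. -/
theorem mk_level_le {K : Type u} [LinearOrder K] [WellFoundedLT K] (r : T → K)
    (hr : ∀ a b, TreeLT c a b → r a < r b)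
    (hr' : ∀ b k, k < r b → ∃ a, TreeLT c a b ∧ r a = k) (k : K) :
    #(r ⁻¹' {k}) ≤ #M ^ #(Iio k) := by
  choose p hp hpr using hr'
  have huniq : ∀ b a (h : TreeLT c a b), p b (r a) (hr a b h) = a := by
    intro b a h
    have h' := hp b (r a) (hr a b h)
    have e := hpr b (r a) (hr a b h)
    rcases lt_trichotomy (p b (r a) (hr a b h)) a with hlt | heq | hgt
    · exact absurd e (hr _ _ (total h' h hlt)).ne
    · exact heq
    · exact absurd e (hr _ _ (total h h' hgt)).ne'
  have huniq' : ∀ a b j (h : TreeLT c a b) (hj : j < r b), r a = j → p b j hj = a := by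
    rintro a b _ h _ rfl
    exact huniq b a h
  -- Induction on the level: the code of a predecessor is the restriction of the code of `b`, so
  -- equal codes force equal predecessors.
  have hinj : ∀ j b b', r b = j → r b' = j →
      (∀ i (hi : i < r b) (hi' : i < r b'), c (p b i hi) b = c (p b' i hi') b') → b = b' := by
    intro j
    induction j using WellFoundedLT.induction with
    | _ j ih =>
      rintro b b' rfl hb' hcode
      have hp_eq : ∀ i (hi : i < r b) (hi' : i < r b'), p b i hi = p b' i hi' := by
        intro i hi hi'
        refine ih i hi _ _ (hpr _ _ _) (hpr _ _ _) fun l hl hl' => ?_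
        have e : ∀ d (hd : i < r d) (hl : l < r (p d i hd)) (hl' : l < r d),
            c (p (p d i hd) l hl) (p d i hd) = c (p d l hl') d := by
          intro d hd hl hl'
          have h1 := hp (p d i hd) l hl
          have h2 := h1.trans (hp d i hd)
          rw [h1.color_eq (hp d i hd), huniq' _ d l h2 hl' (hpr _ _ _)]
        have h0 : l < r b := by rw [hpr] at hl; exact hl.trans hi
        rw [e b hi hl h0, e b' hi' hl' (hb'.symm ▸ h0)]
        exact hcode _ _ _
      have half : ∀ x, TreeLT c x b → TreeLT c x b' ∧ c x b = c x b' := by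
        intro x hx
        have h1 := hr x b hx
        have h2 : r x < r b' := hb'.symm ▸ h1
        have e1 := huniq b x hx
        have e2 : p b' (r x) h2 = x := (hp_eq _ h1 h2).symm.trans e1
        refine ⟨e2 ▸ hp b' (r x) h2, ?_⟩
        have := hcode _ h1 h2
        rwa [e1, e2] at this
      refine eq_of_forall (fun x => ⟨fun hx => (half x hx).1, fun hx => ?_⟩)
        fun x hx => (half x hx).2
      have h2 := hr x b' hx
      have h1 : r x < r b := hb' ▸ h2
      have e1 : p b (r x) h1 = x := (hp_eq _ h1 h2).trans (huniq b' x hx)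
      exact e1 ▸ hp b (r x) h1
  rw [power_def]
  refine mk_le_of_injective (f := fun (b : r ⁻¹' {k}) (j : Iio k) =>
    c (p b.1 j.1 (lt_of_lt_of_eq j.2 b.2.symm)) b.1) ?_
  intro b b' hcode
  exact Subtype.ext (hinj k b.1 b'.1 b.2 b'.2 fun i hi _ =>
    congrFun hcode ⟨i, lt_of_lt_of_eq hi b.2⟩)

/-- A colouring with fewer than `κ` colours whose canonical tree has branches shorter than `κ` lives
on a set of size at most `2^{<κ}`. -/
theorem mk_le_two_powerlt {κ : Cardinal.{u}} (hκ : ℵ₀ ≤ κ) (hM : #M < κ)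
    (hb : ∀ b, #{a | TreeLT c a b} < κ) : #T ≤ (2 : Cardinal.{u}) ^< κ := by
  let r : T → κ.ord.ToType := fun b =>
    Ordinal.ToType.mk ⟨IsWellFounded.rank (TreeLT c) b, rank_lt_ord (hb b)⟩
  have hr : ∀ a b, TreeLT c a b → r a < r b := fun a b h =>
    Ordinal.ToType.mk.lt_iff_lt.2 (IsWellFounded.rank_lt_of_rel h)
  have hr' : ∀ b k, k < r b → ∃ a, TreeLT c a b ∧ r a = k := by
    intro b k hk
    obtain ⟨o, rfl⟩ := Ordinal.ToType.mk.surjective k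
    obtain ⟨a, ha, hao⟩ := exists_rank_eq (Ordinal.ToType.mk.lt_iff_lt.1 hk)
    exact ⟨a, ha, congrArg (fun o => Ordinal.ToType.mk o) (Subtype.ext hao)⟩
  refine (mk_le_mk_mul_of_mk_preimage_le r fun k => (mk_level_le r hr hr' k).trans
    (power_le_two_powerlt hκ hM (mk_Iio_ord_lt k))).trans ?_
  rw [mk_ord_toType]
  exact mul_two_powerlt_le hκ

end TreeLT

/-! ### Counting disjoint boxes -/

/-- Along a branch of the canonical tree which separates boxes, each coordinate is used at most `α`
times and only coordinates supporting the last box are used. -/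
theorem mk_branch_le {T I : Type u} {X : I → Type u} [∀ i, TopologicalSpace (X i)]
    {α : Cardinal.{u}} (hα : ∀ i, ∀ A : Set (Set (X i)), IsCellular A → #A ≤ α)
    (U : T → ∀ i, Set (X i)) (hUo : ∀ t i, IsOpen (U t i)) (hUn : ∀ t i, (U t i).Nonempty)
    (R : T → T → Prop) (s : T → T → I) (b : T)
    (hs : ∀ a, R a b → Disjoint (U a (s a b)) (U b (s a b)))
    (hR : ∀ x a, R x b → R a b → x ≠ a → s x b = s a b →
      Disjoint (U x (s x b)) (U a (s x b))) :
    #{a | R a b} ≤ #{i | U b i ≠ Set.univ} * α := by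
  let f : {a | R a b} → {i | U b i ≠ Set.univ} := fun a => ⟨s a.1 b, fun h => by
    have h' := hs a.1 a.2
    rw [h, disjoint_univ] at h'
    exact (hUn _ _).ne_empty h'⟩
  refine mk_le_mk_mul_of_mk_preimage_le f fun j => ?_
  let g : f ⁻¹' {j} → Set (X j.1) := fun a => U a.1.1 j.1
  have hdisj : ∀ x y, x ≠ y → Disjoint (g x) (g y) := by
    intro x y hxy
    have hx : s x.1.1 b = j.1 := congrArg Subtype.val x.2
    have hy : s y.1.1 b = j.1 := congrArg Subtype.val y.2
    have := hR x.1.1 y.1.1 x.1.2 y.1.2 (fun h => hxy (Subtype.ext (Subtype.ext h)))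
      (hx.trans hy.symm)
    rwa [hx] at this
  have hinj : Function.Injective g := by
    intro x y hxy
    by_contra hne
    have := hdisj x y hne
    rw [hxy, disjoint_self] at this
    exact (hUn y.1.1 j.1).ne_empty this
  rw [← mk_range_eq g hinj]
  refine hα j.1 _ ⟨?_, ?_⟩
  · rintro _ ⟨x, rfl⟩
    exact ⟨hUo _ _, hUn _ _⟩
  · rintro _ ⟨x, rfl⟩ _ ⟨y, rfl⟩ hxy
    exact hdisj x y fun h => hxy (congrArg g h)

/-- A family of pairwise disjoint boxes whose supports all have the same size `μ < κ` has at most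
`2^{<κ}` members. -/
theorem mk_boxes_le_of_mk_support_eq {T I : Type u} {X : I → Type u} [∀ i, TopologicalSpace (X i)]
    {α κ μ : Cardinal.{u}} (hκ : ℵ₀ ≤ κ) (hακ : α < κ) (hμ : μ < κ)
    (hα : ∀ i, ∀ A : Set (Set (X i)), IsCellular A → #A ≤ α)
    (U : T → ∀ i, Set (X i)) (hUo : ∀ t i, IsOpen (U t i)) (hUn : ∀ t i, (U t i).Nonempty)
    (hU : ∀ t, #{i | U t i ≠ Set.univ} = μ)
    (hd : ∀ a b, a ≠ b → ∃ i, Disjoint (U a i) (U b i)) : #T ≤ (2 : Cardinal.{u}) ^< κ := by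
  rcases isEmpty_or_nonempty I with hI | hI
  · have : Subsingleton T := ⟨fun a b => by_contra fun h => hI.elim (hd a b h).choose⟩
    exact (le_one_iff_subsingleton.2 this).trans
      ((one_le_aleph0.trans hκ).trans (le_two_powerlt κ))
  choose! s hs using hd
  obtain ⟨_, _⟩ := exists_wellFoundedLT T
  have hmem : ∀ a b, a ≠ b → U a (s a b) ≠ Set.univ := fun a b hab h => by
    have h' := hs a b hab
    rw [h, univ_disjoint] at h'
    exact (hUn _ _).ne_empty h'
  have he : ∀ t, Nonempty ({i | U t i ≠ Set.univ} ≃ μ.out) := fun t =>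
    Cardinal.eq.1 ((hU t).trans μ.mk_out.symm)
  classical
  let e := fun t => (he t).some
  -- The value `none` can only occur on the diagonal, by `hmem`.
  let c : T → T → Option μ.out := fun a b =>
    if h : U a (s a b) ≠ Set.univ then some (e a ⟨s a b, h⟩) else none
  have hc : ∀ x a b, x ≠ a → x ≠ b → c x a = c x b → s x a = s x b := by
    intro x a b hxa hxb h
    simp only [c, dif_pos (hmem x a hxa), dif_pos (hmem x b hxb), Option.some.injEq,
      EmbeddingLike.apply_eq_iff_eq, Subtype.mk.injEq] at h
    exact h
  refine TreeLT.mk_le_two_powerlt (c := c) hκ ?_ fun b => ?_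
  · rw [mk_option, mk_out]
    exact add_lt_of_lt hκ hμ (one_lt_aleph0.trans_le hκ)
  · refine (mk_branch_le hα U hUo hUn (TreeLT c) s b (fun a ha => hs a b ha.lt.ne) ?_).trans_lt
      (mul_lt_of_lt hκ ((hU b).trans_lt hμ) hακ)
    -- Colours from `x` are constant along the branch and determine the coordinate, so `x` is
    -- separated from `a` where it is separated from `b`.
    have key : ∀ x a, TreeLT c x b → TreeLT c a b → x < a →
        Disjoint (U x (s x b)) (U a (s x b)) := by
      intro x a hx ha hxa
      rw [← hc x a b hxa.ne hx.lt.ne ((TreeLT.total hx ha hxa).color_eq ha)]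
      exact hs x a hxa.ne
    intro x a hx ha hne hs
    rcases hne.lt_or_gt with h | h
    · exact key x a hx ha h
    · rw [hs]
      exact (key a x ha hx h).symm

/-- If `κ` is infinite and exceeds the size of all cellular families in the factors, a family of
pairwise disjoint boxes with supports smaller than `κ` has at most `2^{<κ}` members. -/
theorem mk_boxes_le {T I : Type u} {X : I → Type u} [∀ i, TopologicalSpace (X i)]
    {α κ : Cardinal.{u}} (hκ : ℵ₀ ≤ κ) (hακ : α < κ)
    (hα : ∀ i, ∀ A : Set (Set (X i)), IsCellular A → #A ≤ α)
    (U : T → ∀ i, Set (X i)) (hUo : ∀ t i, IsOpen (U t i)) (hUn : ∀ t i, (U t i).Nonempty)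
    (hU : ∀ t, #{i | U t i ≠ Set.univ} < κ)
    (hd : ∀ a b, a ≠ b → ∃ i, Disjoint (U a i) (U b i)) : #T ≤ (2 : Cardinal.{u}) ^< κ := by
  let f : T → κ.ord.ToType := fun t =>
    Ordinal.ToType.mk ⟨(#{i | U t i ≠ Set.univ}).ord, ord_lt_ord.2 (hU t)⟩
  refine (mk_le_mk_mul_of_mk_preimage_le f fun k => ?_).trans
    ((mul_le_mul_left (mk_ord_toType κ).le _).trans (mul_two_powerlt_le hκ))
  obtain ⟨⟨o, ho⟩, rfl⟩ := Ordinal.ToType.mk.surjective k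
  refine mk_boxes_le_of_mk_support_eq hκ hακ (lt_ord.1 ho) hα (fun t => U t.1)
    (fun t => hUo t.1) (fun t => hUn t.1) (fun t => ?_)
    fun a b hab => hd a.1 b.1 fun h => hab (Subtype.ext h)
  have h := congrArg Subtype.val (Ordinal.ToType.mk.injective t.2)
  exact (card_ord _).symm.trans (congrArg Ordinal.card h)

/-! ### Souslin numbers -/

section Souslin

variable {X : Type u} [TopologicalSpace X]

theorem IsCellular.mono {A B : Set (Set X)} (hA : IsCellular A) (h : B ⊆ A) : IsCellular B :=
  ⟨fun U hU => hA.1 U (h hU), hA.2.subset h⟩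

/-- Subfamilies of cellular families are cellular, so the attained sizes are closed downwards and
the first missing one bounds them all. -/
theorem IsCellular.mk_lt_souslinNumber {A : Set (Set X)} (hA : IsCellular A) :
    #A < souslinNumber X := by
  by_contra! h
  obtain ⟨B, hB, hBc⟩ := le_mk_iff_exists_subset.1 h
  exact csInf_mem (souslinNumber_set_nonempty X) ⟨B, hA.mono hB, hBc⟩

theorem exists_isCellular_of_lt_souslinNumber {c : Cardinal.{u}} (hc : c < souslinNumber X) :
    ∃ A : Set (Set X), IsCellular A ∧ #A = c :=
  not_not.1 (notMem_of_lt_csInf' hc)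

theorem souslinNumber_le_succ {c : Cardinal.{u}}
    (h : ∀ A : Set (Set X), IsCellular A → #A ≤ c) : souslinNumber X ≤ Order.succ c :=
  csInf_le' fun ⟨A, hA, hc⟩ => ((h A hA).trans_lt (Order.lt_succ c)).ne hc

theorem exists_disjoint_open_pair (h : 3 ≤ souslinNumber X) :
    ∃ V : Bool → Set X, (∀ b, IsOpen (V b)) ∧ (∀ b, (V b).Nonempty) ∧
      ∀ b, Disjoint (V b) (V !b) := by
  obtain ⟨A, hA, hA2⟩ := exists_isCellular_of_lt_souslinNumber (c := 2)
    (lt_of_lt_of_le (by exact_mod_cast Nat.lt_succ_self 2) h)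
  obtain ⟨x, y, hxy, -⟩ := mk_eq_two_iff.1 hA2
  have hd : Disjoint x.1 y.1 := hA.2 x.2 y.2 fun h => hxy (Subtype.ext h)
  refine ⟨fun b => cond b x.1 y.1, ?_, ?_, ?_⟩
  · rintro (_ | _)
    exacts [(hA.1 _ y.2).1, (hA.1 _ x.2).1]
  · rintro (_ | _)
    exacts [(hA.1 _ y.2).2, (hA.1 _ x.2).2]
  · rintro (_ | _)
    exacts [hd.symm, hd]

end Souslin

/-! ### Bounds for the box product -/

section KappaBox

variable {I : Type u} {X : I → Type u} [∀ i, TopologicalSpace (X i)] {κ : Cardinal.{u}}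

theorem mk_cellular_kappaBox_le {α : Cardinal.{u}} (hκ : ℵ₀ ≤ κ) (hακ : α < κ)
    (hα : ∀ i, ∀ A : Set (Set (X i)), IsCellular A → #A ≤ α)
    (A : Set (Set (KappaBox X κ))) (hA : IsCellular A) : #A ≤ (2 : Cardinal.{u}) ^< κ := by
  have hbase : ∀ s : A, ∃ U : ∀ i, Set (X i), (∀ i, IsOpen (U i)) ∧ (∀ i, (U i).Nonempty) ∧
      #{i | U i ≠ Set.univ} < κ ∧ Set.univ.pi U ⊆ s.1 := by
    intro s
    obtain ⟨x, hx⟩ := (hA.1 s.1 s.2).2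
    obtain ⟨_, ⟨U, hUo, hU, rfl⟩, hxU, hUs⟩ :=
      @IsTopologicalBasis.exists_subset_of_mem_open _ (kappaBoxTopology X κ) _
        (isTopologicalBasis_canonicalOpens X κ hκ) _ _ hx (hA.1 s.1 s.2).1
    exact ⟨U, hUo, fun i => ⟨x i, hxU i trivial⟩, hU, hUs⟩
  choose U hUo hUn hU hUs using hbase
  refine mk_boxes_le hκ hακ hα U hUo hUn hU fun a b hab => ?_
  have hd : Disjoint (Set.univ.pi (U a)) (Set.univ.pi (U b)) :=
    (hA.2 a.2 b.2 fun h => hab (Subtype.ext h)).mono (hUs a) (hUs b)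
  rwa [disjoint_univ_pi] at hd

/-- A family of pairwise incompatible partial functions `I → Bool` with domains smaller than `κ`
yields an equipotent cellular family. -/
theorem mk_lt_souslinNumber_kappaBox (hX : ∀ i, 3 ≤ souslinNumber (X i)) {T : Type u}
    (P : T → I → Option Bool) (hP : ∀ t, #{i | P t i ≠ none} < κ)
    (hd : ∀ a b, a ≠ b → ∃ i x, P a i = some x ∧ P b i = some !x) :
    #T < souslinNumber (KappaBox X κ) := by
  choose V hVo hVn hVd using fun i => exists_disjoint_open_pair (hX i)
  let U : T → ∀ i, Set (X i) := fun t i => (P t i).elim Set.univ (V i)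
  have hUo : ∀ t i, IsOpen (U t i) := by
    intro t i
    cases h : P t i <;> simp [U, h, hVo]
  have hUn : ∀ t i, (U t i).Nonempty := by
    intro t i
    cases h : P t i
    · simpa [U, h] using (hVn i true).mono (subset_univ _)
    · simp [U, h, hVn]
  let g : T → Set (KappaBox X κ) := fun t => Set.univ.pi (U t)
  have hgd : ∀ a b, a ≠ b → Disjoint (g a) (g b) := by
    intro a b hab
    obtain ⟨i, x, ha, hb⟩ := hd a b hab
    refine disjoint_univ_pi.2 ⟨i, ?_⟩
    simpa [U, ha, hb] using hVd i x
  have hgn : ∀ t, (g t).Nonempty := fun t => univ_pi_nonempty_iff.2 (hUn t)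
  have hg : Function.Injective g := by
    intro a b hab
    by_contra hne
    have := hgd a b hne
    rw [hab, disjoint_self] at this
    exact (hgn b).ne_empty this
  rw [← mk_range_eq g hg]
  refine IsCellular.mk_lt_souslinNumber ⟨?_, ?_⟩
  · rintro _ ⟨t, rfl⟩
    refine ⟨isOpen_generateFrom_of_mem ⟨U t, hUo t, ?_, rfl⟩, hgn t⟩
    have hsub : {i | U t i ≠ Set.univ} ⊆ {i | P t i ≠ none} :=
      fun i (hi : U t i ≠ Set.univ) h => hi (by simp [U, show P t i = none from h])
    exact (mk_le_mk_of_subset hsub).trans_lt (hP t)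
  · rintro _ ⟨x, rfl⟩ _ ⟨y, rfl⟩ hxy
    exact hgd x y fun h => hxy (congrArg g h)

theorem mk_fun_bool (S : Type u) : #(S → Bool) = 2 ^ #S := by
  simp

theorem two_powerlt_lt_souslinNumber_of_mk_lt (hX : ∀ i, 3 ≤ souslinNumber (X i))
    (hI : κ ≤ Order.succ #I) (hIκ : #I < κ) :
    (2 : Cardinal.{u}) ^< κ < souslinNumber (KappaBox X κ) := by
  refine lt_of_le_of_lt ?_ (mk_lt_souslinNumber_kappaBox hX
    (T := I → Bool) (fun t i => some (t i)) (fun t => (mk_set_le _).trans_lt hIκ) ?_)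
  -- Each `x < κ ≤ (#I)⁺` is at most `#I`.
  · rw [powerlt_le]
    intro x hx
    rw [mk_fun_bool]
    exact power_le_power_left two_ne_zero (Order.lt_succ_iff.1 (hx.trans_le hI))
  · intro a b hab
    obtain ⟨i, hi⟩ := Function.ne_iff.1 hab
    exact ⟨i, a i, rfl, congrArg some (Bool.eq_not_of_ne (Ne.symm hi))⟩

/-- The partial function on `K ⊕ K` which on the first copy is the sequence `0, …, 0, 1` ending
at `k` and on the second copy is `f`. -/
noncomputable def selectorCode {K : Type u} [LinearOrder K] (t : Σ k : K, (Iio k → Bool)) :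
    K ⊕ K → Option Bool
  | .inl j => if j < t.1 then some false else if j = t.1 then some true else none
  | .inr j => if h : j < t.1 then some (t.2 ⟨j, h⟩) else none

/-- Codes of different lengths clash in the first copy at the smaller endpoint; codes of equal
length clash in the second, where their functions differ. -/
theorem selectorCode_incompatible {K : Type u} [LinearOrder K]
    {a b : Σ k : K, (Iio k → Bool)} (hab : a ≠ b) :
    ∃ i x, selectorCode a i = some x ∧ selectorCode b i = some !x := by
  obtain ⟨k, f⟩ := a
  obtain ⟨l, g⟩ := b
  rcases lt_trichotomy k l with h | rfl | h
  · exact ⟨.inl k, true, by simp [selectorCode], by simp [selectorCode, h]⟩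
  · obtain ⟨j, hj⟩ := Function.ne_iff.1 fun h : f = g => hab (by rw [h])
    have hjk : j.1 < k := j.2
    refine ⟨.inr j.1, f j, by simp [selectorCode, hjk], ?_⟩
    simpa [selectorCode, hjk] using Bool.eq_not_of_ne (Ne.symm hj)
  · exact ⟨.inl l, false, by simp [selectorCode, h], by simp [selectorCode]⟩

theorem mk_selectorCode_lt (hκ : ℵ₀ ≤ κ) (t : Σ k : κ.ord.ToType, (Iio k → Bool)) :
    #{i | selectorCode t i ≠ none} < κ := by
  have hsub : {i | selectorCode t i ≠ none} ⊆
      Sum.inl '' (insert t.1 (Iio t.1)) ∪ Sum.inr '' Iio t.1 := by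
    rintro (j | j) hj
    · refine Or.inl ⟨j, ?_, rfl⟩
      by_contra h
      simp only [mem_insert_iff, mem_Iio, not_or] at h
      exact hj (by simp [selectorCode, h])
    · refine Or.inr ⟨j, ?_, rfl⟩
      by_contra h
      exact hj (dif_neg h)
  refine (mk_le_mk_of_subset hsub).trans_lt ((mk_union_le _ _).trans_lt (add_lt_of_lt hκ ?_ ?_))
  · exact mk_image_le.trans_lt (mk_insert_le.trans_lt
      (add_lt_of_lt hκ (mk_Iio_ord_lt _) (one_lt_aleph0.trans_le hκ)))
  · exact mk_image_le.trans_lt (mk_Iio_ord_lt _)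

theorem two_powerlt_le_mk_sigma (κ : Cardinal.{u}) :
    (2 : Cardinal.{u}) ^< κ ≤ #(Σ k : κ.ord.ToType, (Iio k → Bool)) := by
  rw [powerlt_le]
  intro x hx
  let k : κ.ord.ToType := Ordinal.ToType.mk ⟨x.ord, ord_lt_ord.2 hx⟩
  have hk : #(Iio k) = x := by
    rw [← Ordinal.card_type (· < · : Iio k → Iio k → Prop), Ordinal.type_Iio_lt]
    exact (congrArg Ordinal.card (Ordinal.typein_enum _ _)).trans (card_ord x)
  calc (2 : Cardinal.{u}) ^ x = #(Iio k → Bool) := by rw [mk_fun_bool, hk]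
    _ ≤ _ := mk_le_of_injective (f := fun f => ⟨k, f⟩) fun f g h => by simpa using h

/-- As `κ + κ = κ ≤ #I`, both copies embed in `I`, and the codes are extended by `none`. -/
theorem two_powerlt_lt_souslinNumber_of_le_mk (hκ : ℵ₀ ≤ κ) (hX : ∀ i, 3 ≤ souslinNumber (X i))
    (hI : κ ≤ #I) : (2 : Cardinal.{u}) ^< κ < souslinNumber (KappaBox X κ) := by
  have hφ : #(κ.ord.ToType ⊕ κ.ord.ToType) ≤ #I := by
    simpa [add_eq_self hκ] using hI
  obtain ⟨φ⟩ := hφ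
  refine (two_powerlt_le_mk_sigma κ).trans_lt (mk_lt_souslinNumber_kappaBox hX
    (fun t => Function.extend φ (selectorCode t) fun _ => none) (fun t => ?_) ?_)
  · have hsub : {i | Function.extend φ (selectorCode t) (fun _ => none) i ≠ none} ⊆
        φ '' {j | selectorCode t j ≠ none} := by
      intro i hi
      by_cases h : ∃ j, φ j = i
      · obtain ⟨j, rfl⟩ := h
        refine ⟨j, ?_, rfl⟩
        simpa [φ.injective.extend_apply] using hi
      · exact absurd (Function.extend_apply' _ _ _ h) hi
    exact ((mk_le_mk_of_subset hsub).trans mk_image_le).trans_lt (mk_selectorCode_lt hκ t)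
  · intro a b hab
    obtain ⟨i, x, ha, hb⟩ := selectorCode_incompatible hab
    exact ⟨φ i, x, by rw [φ.injective.extend_apply, ha], by rw [φ.injective.extend_apply, hb]⟩

end KappaBox

theorem corollary4p40 (α κ : Cardinal.{u}) (hα : 3 ≤ α) (hκ : ℵ₀ ≤ κ)
    {I : Type u} (X : I → Type u) [∀ i, TopologicalSpace (X i)]
    (hI : κ ≤ Order.succ #I)
    (hX : ∀ i, 3 ≤ souslinNumber (X i) ∧ souslinNumber (X i) ≤ Order.succ α)
    (hακ : Order.succ α ≤ κ) :
    souslinNumber (KappaBox X κ) = Order.succ ((2 : Cardinal.{u}) ^< κ) := by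
  refine le_antisymm (souslinNumber_le_succ (mk_cellular_kappaBox_le hκ
    ((Order.lt_succ α).trans_le hακ) fun i A hA =>
      Order.lt_succ_iff.1 (hA.mk_lt_souslinNumber.trans_le (hX i).2))) (Order.succ_le_of_lt ?_)
  rcases lt_or_ge #I κ with h | h
  · exact two_powerlt_lt_souslinNumber_of_mk_lt (fun i => (hX i).1) hI h
  · exact two_powerlt_lt_souslinNumber_of_le_mk hκ (fun i => (hX i).1) h
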